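/- Conventions. All spaces are $T_0$; $\mathbb R_+=[0,\infty)$ and $\overline{\mathbb R}_+=[0,\infty]$ carry the Scott topology, so a map into $\overline{\mathbb R}_+$ is continuous iff it is lower semicontinuous; $0\cdot\infty=0$. Let $\mathcal K$ be a K-category, that is, a full subcategory of the $T_0$ spaces such that: (1) homeomorphic copies of $\mathcal K$-spaces are $\mathcal K$-spaces; (2) all sober spaces are $\mathcal K$-spaces; (3) in a sober space, any intersection of $\mathcal K$-subspaces is a $\mathcal K$-space; (4) for every continuous map between sober spaces, inverse images of $\mathcal K$-subspaces are $\mathcal K$-subspaces. For a space $X$, let $X^{\mathrm s}$ be its sobrification, i.e. the set of irreducible closed subsets of $X$ with the lower Vietoris topology, and let $\mathcal K_{\mathrm c}(X)$ be the smallest $\mathcal K$-subspace of $X^{\mathrm s}$ containing all $\eta_X(x)=\overline{\{x\}}$, $x\in X$. For continuous $h\colon X\to Y$, $\mathcal K_{\mathrm c}(h)\colon\mathcal K_{\mathrm c}(X)\to\mathcal K_{\mathrm c}(Y)$ is the unique continuous map with $\mathcal K_{\mathrm c}(h)\circ\eta_X=\eta_Y\circ h$. A cone is a commutative monoid with a scalar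 multiplication by $\mathbb R_+$ satisfying the axioms of a vector space; a topological cone is a cone with a $T_0$ topology making addition and scalar multiplication jointly continuous; it is weakly locally convex if every open neighbourhood of a point contains a convex (not necessarily open) neighbourhood of that point. A function $f$ from a cone to $\overline{\mathbb R}_+$ is homogeneous if $f(ra)=rf(a)$ for all $r\in\mathbb R_+$, superadditive if $f(a+b)\ge f(a)+f(b)$, subadditive if $f(a+b)\le f(a)+f(b)$, additive if $f(a+b)=f(a)+f(b)$; it is superlinear (resp. sublinear, linear) if it is homogeneous and superadditive (resp. subadditive, additive). Let $\mathcal V_wX$ be the cone of continuous valuations on $X$ with values in $\overline{\mathbb R}_+$ and pointwise operations, with the weak topology (subbasic open sets $\{\mu:\mu(U)>r\}$, $U\subseteq X$ open, $r\in\mathbb R_+$), and let $\mathcal V_{\mathrm s}X$ be the subspace of simple valuations $\sum_{i=1}^n r_i\delta_{x_i}$, $r_i \in \mathbb R_+$. The space $\mathcal K_{\mathrm c}(\mathcal V_{\mathrm s}X)$ is identified with the smallest $\mathcal K$-subspace of $\mathcal V_wX$ containing $\mathcal V_{\mathrm s}X$, which is a subcone of $\mathcal V_wX$, and so $\mathcal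 K_{\mathrm c}(\mathcal V_{\mathrm s}X)$ is a cone. Theorem. Let $C$ be a weakly locally convex topological cone. Then there is a (necessarily unique) continuous map $\alpha_C\colon\mathcal V_{\mathrm s}C\to C$ with $\alpha_C(\sum_i r_i\delta_{x_i})=\sum_i r_ix_i$ for all simple valuations, and, with $\delta_C\colon C\to\mathcal V_{\mathrm s}C$, $x\mapsto\delta_x$, the operations $$x+y=\mathcal K_{\mathrm c}(\alpha_C)\bigl(\mathcal K_{\mathrm c}(\delta_C)(x)+\mathcal K_{\mathrm c}(\delta_C)(y)\bigr),\qquad r\cdot x=\mathcal K_{\mathrm c}(\alpha_C)\bigl(r\cdot\mathcal K_{\mathrm c}(\delta_C)(x)\bigr)$$ make $\mathcal K_{\mathrm c}(C)$ a cone. With respect to this cone structure, every lower semicontinuous map $f\colon C\to\overline{\mathbb R}_+$ has a unique lower semicontinuous extension $\overline f\colon\mathcal K_{\mathrm c}(C)\to\overline{\mathbb R}_+$, $\overline f\circ\eta_C=f$, and $f$ is homogeneous (resp. superadditive, subadditive) if and only if $\overline f$ is homogeneous (resp. superadditive, subadditive). Consequently, $f$ is superlinear (resp. sublinear, linear) if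 and only if $\overline f$ is superlinear (resp. sublinear, linear). -/

import Mathlib

open scoped NNReal ENNReal Topology

universe u

/-! ### Sobrification -/

/-- The canonical sobrification of `X`: the set of irreducible closed subsets of `X`. -/
def Sob (X : Type u) [TopologicalSpace X] : Type u :=
  TopologicalSpace.IrreducibleCloseds X

namespace Sob

variable {X : Type u} [TopologicalSpace X]

/-- The underlying irreducible closed set of a point of the sobrification. -/
def carrier (A : Sob X) : Set X := TopologicalSpace.IrreducibleCloseds.carrier A

theorem irred (A : Sob X) : IsIrreducible A.carrier :=
  TopologicalSpace.IrreducibleCloseds.isIrreducible' A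

theorem closed (A : Sob X) : IsClosed A.carrier :=
  TopologicalSpace.IrreducibleCloseds.isClosed' A

theorem ext {A B : Sob X} (h : A.carrier = B.carrier) : A = B :=
  TopologicalSpace.IrreducibleCloseds.ext h

/-- The irreducible closed sets that meet `U`. -/
def meets (U : Set X) : Set (Sob X) := {A | (A.carrier ∩ U).Nonempty}

/-- The lower Vietoris topology. The sets `meets U`, with `U` open, are not only a subbasis of it
but all of its open sets, because they are closed under unions and finite intersections. -/
instance : TopologicalSpace (Sob X) where
  IsOpen s := ∃ U : Set X, IsOpen U ∧ s = meets U
  isOpen_univ := ⟨Set.univ, isOpen_univ, by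
    ext A
    simpa [meets] using A.irred.nonempty⟩
  isOpen_inter := by
    rintro _ _ ⟨U, hU, rfl⟩ ⟨V, hV, rfl⟩
    refine ⟨U ∩ V, hU.inter hV, ?_⟩
    ext A
    constructor
    · rintro ⟨h1, h2⟩
      exact A.irred.isPreirreducible U V hU hV h1 h2
    · rintro ⟨x, hx, hxU, hxV⟩
      exact ⟨⟨x, hx, hxU⟩, ⟨x, hx, hxV⟩⟩
  isOpen_sUnion := by
    intro S hS
    refine ⟨⋃₀ {U | IsOpen U ∧ meets U ∈ S}, isOpen_sUnion fun U hU => hU.1, ?_⟩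
    ext A
    constructor
    · rintro ⟨s, hs, hA⟩
      obtain ⟨U, hU, rfl⟩ := hS s hs
      obtain ⟨x, hx, hxU⟩ := hA
      exact ⟨x, hx, U, ⟨hU, hs⟩, hxU⟩
    · rintro ⟨x, hx, U, ⟨hU, hs⟩, hxU⟩
      exact ⟨meets U, hs, x, hx, hxU⟩

theorem isOpen_iff {s : Set (Sob X)} : IsOpen s ↔ ∃ U : Set X, IsOpen U ∧ s = meets U := Iff.rfl

theorem isOpen_meets {U : Set X} (hU : IsOpen U) : IsOpen (meets U) := ⟨U, hU, rfl⟩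

/-- The canonical map of `X` into its sobrification, `x ↦ closure {x}`. -/
def unit (x : X) : Sob X where
  carrier := closure {x}
  isIrreducible' := isIrreducible_singleton.closure
  isClosed' := isClosed_closure

theorem unit_mem_meets {U : Set X} (hU : IsOpen U) (x : X) : unit x ∈ meets U ↔ x ∈ U := by
  change (closure {x} ∩ U).Nonempty ↔ x ∈ U
  rw [closure_inter_open_nonempty_iff hU]
  simp

theorem continuous_unit : Continuous (unit : X → Sob X) := by
  refine ⟨?_⟩
  rintro _ ⟨U, hU, rfl⟩
  have h : unit ⁻¹' meets U = U := Set.ext fun x => unit_mem_meets hU x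
  rwa [h]

theorem mem_meets_compl (A : Sob X) (F : Set X) : A ∈ meets Fᶜ ↔ ¬ A.carrier ⊆ F := by
  rw [Set.not_subset]
  rfl

instance : T0Space (Sob X) := by
  refine ⟨fun A B h => ?_⟩
  have key : ∀ F : Set X, IsClosed F → (A.carrier ⊆ F ↔ B.carrier ⊆ F) := by
    intro F hF
    have := h.mem_open_iff (isOpen_meets hF.isOpen_compl)
    rw [mem_meets_compl, mem_meets_compl] at this
    exact not_iff_not.mp this
  exact ext (Set.Subset.antisymm ((key _ B.closed).2 subset_rfl) ((key _ A.closed).1 subset_rfl))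

instance : QuasiSober (Sob X) := by
  refine ⟨fun {Z} hZ hZc => ?_⟩
  obtain ⟨U, hU, hZU⟩ := isOpen_iff.1 hZc.isOpen_compl
  have hmem : ∀ A : Sob X, A ∈ Z ↔ A.carrier ⊆ Uᶜ := by
    intro A
    have h1 : A ∈ Zᶜ ↔ A ∈ meets (Uᶜ)ᶜ := by rw [hZU, compl_compl]
    rw [mem_meets_compl, Set.mem_compl_iff] at h1
    exact not_iff_not.mp h1
  have hpt : ∀ x, x ∈ Uᶜ → unit x ∈ Z := fun x hx =>
    (hmem _).2 (closure_minimal (Set.singleton_subset_iff.2 hx) hU.isClosed_compl)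
  have hirr : IsIrreducible Uᶜ := by
    constructor
    · obtain ⟨A, hA⟩ := hZ.nonempty
      exact A.irred.nonempty.mono ((hmem A).1 hA)
    · rintro V W hV hW ⟨x, hx, hxV⟩ ⟨y, hy, hyW⟩
      obtain ⟨A, hA, hAV, hAW⟩ := hZ.isPreirreducible _ _ (isOpen_meets hV) (isOpen_meets hW)
        ⟨unit x, hpt x hx, (unit_mem_meets hV x).2 hxV⟩
        ⟨unit y, hpt y hy, (unit_mem_meets hW y).2 hyW⟩
      exact (A.irred.isPreirreducible V W hV hW hAV hAW).mono
        (Set.inter_subset_inter_left _ ((hmem A).1 hA))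
  let F : Sob X := ⟨Uᶜ, hirr, hU.isClosed_compl⟩
  refine ⟨F, ?_⟩
  refine Set.Subset.antisymm
    (closure_minimal (Set.singleton_subset_iff.2 ((hmem F).2 subset_rfl)) hZc) ?_
  intro A hA
  rw [mem_closure_iff]
  rintro _ ⟨V, hV, rfl⟩ hAV
  exact ⟨F, hAV.mono (Set.inter_subset_inter_left _ ((hmem A).1 hA)), rfl⟩

/-- The continuous extension to the sobrification of a continuous map `f` into a sober space: it
sends the irreducible closed set `A` to the generic point of the closure of `f '' A`. -/
noncomputable def extend {S : Type u} [TopologicalSpace S] [QuasiSober S] (f : X → S)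
    (hf : Continuous f) (A : Sob X) : S :=
  (A.irred.image f hf.continuousOn).genericPoint

section extend

variable {S : Type u} [TopologicalSpace S] [QuasiSober S] {f : X → S} (hf : Continuous f)

theorem extend_mem_iff {W : Set S} (hW : IsOpen W) (A : Sob X) :
    extend f hf A ∈ W ↔ A ∈ meets (f ⁻¹' W) := by
  have h := (A.irred.image f hf.continuousOn).isGenericPoint_genericPoint_closure.mem_open_set_iff
    hW
  rw [closure_inter_open_nonempty_iff hW] at h
  refine h.trans ⟨?_, ?_⟩
  · rintro ⟨_, ⟨x, hx, rfl⟩, hxW⟩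
    exact ⟨x, hx, hxW⟩
  · rintro ⟨x, hx, hxW⟩
    exact ⟨f x, ⟨x, hx, rfl⟩, hxW⟩

theorem continuous_extend : Continuous (extend f hf) := by
  refine ⟨fun W hW => ⟨f ⁻¹' W, hW.preimage hf, ?_⟩⟩
  ext A
  exact extend_mem_iff hf hW A

theorem extend_unit [T0Space S] (x : X) : extend f hf (unit x) = f x := by
  apply Inseparable.eq
  rw [inseparable_iff_forall_isOpen]
  intro W hW
  rw [extend_mem_iff hf hW, unit_mem_meets (hW.preimage hf)]
  rfl

theorem isEmbedding_extend (hfi : Topology.IsInducing f) :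
    Topology.IsEmbedding (extend f hf) := by
  have h : Topology.IsInducing (extend f hf) := by
    refine ⟨le_antisymm (continuous_extend hf).le_induced ?_⟩
    rintro _ ⟨U, hU, rfl⟩
    obtain ⟨W, hW, rfl⟩ := hfi.isOpen_iff.1 hU
    exact ⟨W, hW, Set.ext fun A => extend_mem_iff hf hW A⟩
  exact ⟨h, h.injective⟩

end extend

end Sob

/-! ### K-categories and K-completions -/

/-- A K-category: a full subcategory of the category of `T₀` spaces (given by its class of
objects, the `𝒦`-spaces) which is closed under homeomorphic copies, contains all sober spaces,
is closed under intersections of subspaces of sober spaces, and is such that inverse images of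
`𝒦`-subspaces under continuous maps between sober spaces are `𝒦`-subspaces.
Sober means `T₀` and `QuasiSober`. -/
structure KCategory where
  /-- The class of `𝒦`-spaces. -/
  IsKSpace : ∀ (X : Type u) [TopologicalSpace X], Prop
  t0Space : ∀ (X : Type u) [TopologicalSpace X], IsKSpace X → T0Space X
  of_homeomorph : ∀ (X Y : Type u) [TopologicalSpace X] [TopologicalSpace Y],
    Nonempty (X ≃ₜ Y) → IsKSpace X → IsKSpace Y
  of_sober : ∀ (X : Type u) [TopologicalSpace X] [T0Space X] [QuasiSober X], IsKSpace X
  sInter : ∀ (S : Type u) [TopologicalSpace S] [T0Space S] [QuasiSober S] (F : Set (Set S)),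
    (∀ A ∈ F, IsKSpace A) → IsKSpace (⋂₀ F : Set S)
  preimage : ∀ (S T : Type u) [TopologicalSpace S] [T0Space S] [QuasiSober S]
    [TopologicalSpace T] [T0Space T] [QuasiSober T] (f : S → T), Continuous f →
    ∀ B : Set T, IsKSpace B → IsKSpace (f ⁻¹' B)

namespace KCategory

variable (𝒦 : KCategory.{u})

/-- The smallest `𝒦`-subspace of the sober space `S` that contains `Z`. -/
def cl {S : Type u} [TopologicalSpace S] (Z : Set S) : Set S :=
  ⋂₀ {A | Z ⊆ A ∧ 𝒦.IsKSpace A}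

theorem subset_cl {S : Type u} [TopologicalSpace S] (Z : Set S) : Z ⊆ 𝒦.cl Z :=
  Set.subset_sInter fun _ hA => hA.1

theorem cl_subset {S : Type u} [TopologicalSpace S] {Z A : Set S} (hZ : Z ⊆ A)
    (hA : 𝒦.IsKSpace A) : 𝒦.cl Z ⊆ A :=
  Set.sInter_subset_of_mem ⟨hZ, hA⟩

theorem isKSpace_cl {S : Type u} [TopologicalSpace S] [T0Space S] [QuasiSober S] (Z : Set S) :
    𝒦.IsKSpace (𝒦.cl Z) :=
  𝒦.sInter S _ fun _ hA => hA.2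

theorem mapsTo_cl {S T : Type u} [TopologicalSpace S] [T0Space S] [QuasiSober S]
    [TopologicalSpace T] [T0Space T] [QuasiSober T] {f : S → T} (hf : Continuous f)
    {Z : Set S} {B : Set T} (h : Set.MapsTo f Z (𝒦.cl B)) :
    Set.MapsTo f (𝒦.cl Z) (𝒦.cl B) :=
  𝒦.cl_subset h (𝒦.preimage S T f hf _ (𝒦.isKSpace_cl B))

end KCategory

/-- The canonical `𝒦`-completion of `X`: the smallest `𝒦`-subspace of the sobrification of `X`
that contains the image of `X`. -/
def Kc (𝒦 : KCategory.{u}) (X : Type u) [TopologicalSpace X] : Type u :=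
  ↥(𝒦.cl (Set.range (Sob.unit : X → Sob X)))

namespace Kc

variable (𝒦 : KCategory.{u}) {X Y : Type u} [TopologicalSpace X] [TopologicalSpace Y]

instance : TopologicalSpace (Kc 𝒦 X) :=
  inferInstanceAs (TopologicalSpace ↥(𝒦.cl (Set.range (Sob.unit : X → Sob X))))

/-- The canonical map of `X` into its `𝒦`-completion. -/
def unit (x : X) : Kc 𝒦 X := ⟨Sob.unit x, 𝒦.subset_cl _ ⟨x, rfl⟩⟩

theorem extend_mem (f : C(X, Y)) (A : Kc 𝒦 X) :
    Sob.extend (fun x => Sob.unit (f x)) (Sob.continuous_unit.comp f.continuous) A.1 ∈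
      𝒦.cl (Set.range (Sob.unit : Y → Sob Y)) := by
  refine 𝒦.mapsTo_cl (Sob.continuous_extend _) ?_ A.2
  rintro _ ⟨x, rfl⟩
  rw [Sob.extend_unit]
  exact 𝒦.subset_cl _ ⟨f x, rfl⟩

/-- The functor `𝒦_c` on morphisms: `Kc.map 𝒦 f` is the unique continuous map with
`Kc.map 𝒦 f (unit x) = unit (f x)`; see `Kc.continuous_map` and `Kc.map_unit`. It is the
restriction of the map between the sobrifications. -/
noncomputable def map (f : C(X, Y)) (A : Kc 𝒦 X) : Kc 𝒦 Y :=
  ⟨Sob.extend (fun x => Sob.unit (f x)) (Sob.continuous_unit.comp f.continuous) A.1,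
    extend_mem 𝒦 f A⟩

theorem continuous_map (f : C(X, Y)) : Continuous (map 𝒦 f) :=
  ((Sob.continuous_extend _).comp continuous_subtype_val).subtype_mk _

theorem map_unit (f : C(X, Y)) (x : X) : map 𝒦 f (unit 𝒦 x) = unit 𝒦 (f x) :=
  Subtype.ext (Sob.extend_unit (Sob.continuous_unit.comp f.continuous) x)

end Kc

/-! ### Continuous valuations -/

/-- Continuous valuations on `X`. -/
@[ext]
structure Val (X : Type u) [TopologicalSpace X] where
  /-- The value of the valuation on open sets. -/
  toFun : TopologicalSpace.Opens X → ℝ≥0∞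
  strict : toFun ⊥ = 0
  monotone : ∀ U V, U ≤ V → toFun U ≤ toFun V
  modular : ∀ U V, toFun U + toFun V = toFun (U ⊔ V) + toFun (U ⊓ V)
  scott_continuous : ∀ D : Set (TopologicalSpace.Opens X), D.Nonempty → DirectedOn (· ≤ ·) D →
    toFun (sSup D) = ⨆ U ∈ D, toFun U

namespace Val

variable {X : Type u} [TopologicalSpace X]

instance : CoeFun (Val X) fun _ => TopologicalSpace.Opens X → ℝ≥0∞ := ⟨Val.toFun⟩

theorem toFun_injective : Function.Injective (Val.toFun : Val X → _) := fun _ _ h => Val.ext h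

/-- The weak topology, with the subbasis of the sets `[U > r]`. -/
instance : TopologicalSpace (Val X) :=
  TopologicalSpace.generateFrom
    {s | ∃ (U : TopologicalSpace.Opens X) (r : ℝ≥0), s = {μ : Val X | (r : ℝ≥0∞) < μ U}}

theorem isOpen_basic (U : TopologicalSpace.Opens X) (r : ℝ≥0) :
    IsOpen {μ : Val X | (r : ℝ≥0∞) < μ U} :=
  TopologicalSpace.isOpen_generateFrom_of_mem ⟨U, r, rfl⟩

theorem isOpen_lt (U : TopologicalSpace.Opens X) (r : ℝ≥0∞) :
    IsOpen {μ : Val X | r < μ U} := by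
  induction r with
  | top => simp
  | coe r => exact isOpen_basic U r

theorem continuous_of_lsc {Y : Type*} [TopologicalSpace Y] {f : Y → Val X}
    (h : ∀ U, LowerSemicontinuous fun y => f y U) : Continuous f := by
  refine continuous_generateFrom_iff.2 ?_
  rintro _ ⟨U, r, rfl⟩
  exact (h U).isOpen_preimage r

theorem lsc_apply (U : TopologicalSpace.Opens X) :
    LowerSemicontinuous fun μ : Val X => μ U :=
  lowerSemicontinuous_iff_isOpen_preimage.2 fun r => isOpen_lt U r

instance : T0Space (Val X) := by
  refine ⟨fun μ ν h => Val.ext (funext fun U => ?_)⟩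
  refine eq_of_forall_lt_iff fun r => ?_
  exact h.mem_open_iff (isOpen_lt U r)

/-- The zero valuation. -/
instance : Zero (Val X) := ⟨⟨fun _ => 0, rfl, by simp, by simp, by simp⟩⟩

/-- Addition of valuations, `(μ + ν)(U) = μ(U) + ν(U)`. -/
noncomputable instance : Add (Val X) where
  add μ ν :=
    { toFun := fun U => μ U + ν U
      strict := by simp [μ.strict, ν.strict]
      monotone := fun U V h => add_le_add (μ.monotone U V h) (ν.monotone U V h)
      modular := fun U V => by
        rw [add_add_add_comm, μ.modular, ν.modular, add_add_add_comm]
      scott_continuous := fun D hne hD => by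
        rw [μ.scott_continuous D hne hD, ν.scott_continuous D hne hD, iSup_subtype',
          iSup_subtype', iSup_subtype', ENNReal.iSup_add_iSup]
        intro U V
        obtain ⟨W, hW, hUW, hVW⟩ := hD U.1 U.2 V.1 V.2
        exact ⟨⟨W, hW⟩, add_le_add (μ.monotone _ _ hUW) (ν.monotone _ _ hVW)⟩ }

/-- Scalar multiplication of valuations, `(r • μ)(U) = r * μ(U)`. -/
noncomputable instance : SMul ℝ≥0 (Val X) where
  smul r μ :=
    { toFun := fun U => (r : ℝ≥0∞) * μ U
      strict := by simp [μ.strict]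
      monotone := fun U V h => mul_le_mul_right (μ.monotone U V h) _
      modular := fun U V => by rw [← mul_add, ← mul_add, μ.modular]
      scott_continuous := fun D hne hD => by
        simp_rw [μ.scott_continuous D hne hD, ENNReal.mul_iSup] }

noncomputable instance : SMul ℕ (Val X) := ⟨fun n μ => (n : ℝ≥0) • μ⟩

noncomputable instance : AddCommMonoid (Val X) :=
  toFun_injective.addCommMonoid Val.toFun rfl (fun _ _ => rfl) fun μ n => by
    funext U
    change ((n : ℝ≥0) : ℝ≥0∞) * μ U = n • μ U
    simp

/-- Evaluation of valuations on open sets, as an additive map. -/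
noncomputable def evalHom : Val X →+ (TopologicalSpace.Opens X → ℝ≥0∞) where
  toFun := Val.toFun
  map_zero' := rfl
  map_add' _ _ := rfl

noncomputable instance : Module ℝ≥0 (Val X) :=
  toFun_injective.module ℝ≥0 evalHom fun _ _ => rfl

open Classical in
/-- The Dirac mass at `x`. -/
noncomputable def dirac (x : X) : Val X where
  toFun U := if x ∈ U then 1 else 0
  strict := by simp
  monotone U V h := by
    by_cases hU : x ∈ U
    · simp [hU, h hU]
    · simp [hU]
  modular U V := by
    by_cases hU : x ∈ U <;> by_cases hV : x ∈ V <;> simp [hU, hV]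
  scott_continuous D hne hD := by
    by_cases h : ∃ U ∈ D, x ∈ U
    · obtain ⟨U, hU, hx⟩ := h
      rw [if_pos (TopologicalSpace.Opens.mem_sSup.2 ⟨U, hU, hx⟩)]
      refine le_antisymm (le_iSup₂_of_le U hU (by simp [hx])) (iSup₂_le fun V _ => ?_)
      split_ifs <;> simp
    · rw [if_neg (by simpa [TopologicalSpace.Opens.mem_sSup] using h)]
      push Not at h
      symm
      simp only [ENNReal.iSup_eq_zero]
      intro U hU
      simp [h U hU]

/-- The supremum of an irreducible set of valuations is a valuation. -/
noncomputable def irredSup (Z : Set (Val X)) (hZ : IsIrreducible Z) : Val X where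
  toFun U := ⨆ μ : Z, μ.1 U
  strict := by simp [Val.strict]
  monotone U V h := iSup_mono fun μ => μ.1.monotone U V h
  modular U V := by
    have key : ∀ U V : TopologicalSpace.Opens X,
        (⨆ μ : Z, μ.1 U) + (⨆ μ : Z, μ.1 V) = ⨆ μ : Z, (μ.1 U + μ.1 V) := by
      intro U V
      have : Nonempty Z := hZ.nonempty.to_subtype
      refine le_antisymm ?_ (iSup_le fun μ => add_le_add (le_iSup (fun μ : Z => μ.1 U) μ)
        (le_iSup (fun μ : Z => μ.1 V) μ))
      refine ENNReal.iSup_add_iSup_le fun μ ν => ?_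
      by_contra hcon
      rw [not_le] at hcon
      have hle : ∀ κ : Z, κ.1 U + κ.1 V ≤ ⨆ μ : Z, (μ.1 U + μ.1 V) :=
        fun κ => le_iSup (fun μ : Z => μ.1 U + μ.1 V) κ
      have hU : μ.1 U ≠ 0 := fun h => hcon.not_ge (by
        rw [h, zero_add]; exact le_trans le_add_self (hle ν))
      have hV : ν.1 V ≠ 0 := fun h => hcon.not_ge (by
        rw [h, add_zero]; exact le_trans le_self_add (hle μ))
      obtain ⟨a, ha, b, hb, hab⟩ := ENNReal.exists_lt_add_of_lt_add hcon hU hV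
      obtain ⟨κ, hκ, hκU, hκV⟩ := hZ.isPreirreducible _ _ (isOpen_lt U a) (isOpen_lt V b)
        ⟨μ.1, μ.2, ha⟩ ⟨ν.1, ν.2, hb⟩
      exact (hab.trans_le (add_le_add (le_of_lt hκU) (le_of_lt hκV))).not_ge (hle ⟨κ, hκ⟩)
    rw [key, key]
    exact iSup_congr fun μ => μ.1.modular U V
  scott_continuous D hne hD := by
    simp_rw [Val.scott_continuous _ D hne hD]
    rw [iSup_comm]
    refine iSup_congr fun U => ?_
    rw [iSup_comm]

theorem generic_irredSup (Z : Set (Val X)) (hZ : IsIrreducible Z) (hZc : IsClosed Z) :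
    IsGenericPoint (irredSup Z hZ) Z := by
  refine Set.Subset.antisymm (closure_minimal (Set.singleton_subset_iff.2 ?_) hZc) ?_
  · have key : ∀ W : Set (Val X), IsOpen W → irredSup Z hZ ∈ W → (Z ∩ W).Nonempty := by
      intro W hW
      induction hW with
      | basic s hs =>
        obtain ⟨U, r, rfl⟩ := hs
        intro h
        replace h : (r : ℝ≥0∞) < ⨆ μ : Z, μ.1 U := h
        obtain ⟨μ, hμ⟩ := lt_iSup_iff.1 h
        exact ⟨μ.1, μ.2, hμ⟩
      | univ => simpa using hZ.nonempty
      | inter s t hs ht ihs iht => exact fun h => hZ.isPreirreducible s t hs ht (ihs h.1) (iht h.2)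
      | sUnion S hS ih =>
        rintro ⟨s, hs, h⟩
        exact (ih s hs h).mono (Set.inter_subset_inter_right _ (Set.subset_sUnion_of_mem hs))
    by_contra hcon
    obtain ⟨μ, hμ, hμ'⟩ := key Zᶜ hZc.isOpen_compl hcon
    exact hμ' hμ
  · intro μ hμ
    rw [mem_closure_iff]
    intro W hW hμW
    refine ⟨irredSup Z hZ, ?_, rfl⟩
    induction hW with
    | basic s hs =>
      obtain ⟨U, r, rfl⟩ := hs
      exact lt_of_lt_of_le hμW (le_iSup (fun μ : Z => μ.1 U) ⟨μ, hμ⟩)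
    | univ => trivial
    | inter s t hs ht ihs iht => exact ⟨ihs hμW.1, iht hμW.2⟩
    | sUnion S hS ih =>
      obtain ⟨s, hs, h⟩ := hμW
      exact ⟨s, hs, ih s hs h⟩

instance : QuasiSober (Val X) := ⟨fun hZ hZc => ⟨_, generic_irredSup _ hZ hZc⟩⟩

theorem continuous_dirac : Continuous (dirac : X → Val X) := by
  classical
  refine continuous_generateFrom_iff.2 ?_
  rintro _ ⟨U, r, rfl⟩
  by_cases hr : (r : ℝ≥0∞) < 1
  · convert U.isOpen using 1
    ext x
    by_cases hx : x ∈ U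
    · simp [dirac, hx]
      exact_mod_cast hr
    · simp [dirac, hx]
  · convert isOpen_empty using 1
    ext x
    by_cases hx : x ∈ U
    · simpa [dirac, hx] using hr
    · simp [dirac, hx]

theorem continuous_const_add (μ : Val X) : Continuous fun ν : Val X => μ + ν :=
  continuous_of_lsc fun U => (lowerSemicontinuous_const (z := μ U)).add (lsc_apply U)

theorem continuous_const_smul (r : ℝ≥0) : Continuous fun ν : Val X => r • ν := by
  refine continuous_of_lsc fun U => ?_
  exact (ENNReal.continuous_const_mul ENNReal.coe_ne_top).comp_lowerSemicontinuous (lsc_apply U)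
    fun a b h => mul_le_mul_right h _

end Val

/-- The space `𝒱_s X` of simple valuations `∑ rᵢ δ_{xᵢ}`, with the subspace topology. -/
def Vs (X : Type u) [TopologicalSpace X] : Type u :=
  {μ : Val X // ∃ c : X →₀ ℝ≥0, μ = c.sum fun x r => r • Val.dirac x}

namespace Vs

variable {X : Type u} [TopologicalSpace X]

instance : TopologicalSpace (Vs X) :=
  inferInstanceAs (TopologicalSpace {μ : Val X // ∃ c : X →₀ ℝ≥0,
    μ = c.sum fun x r => r • Val.dirac x})

/-- The inclusion of the simple valuations into the continuous valuations. -/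
def toVal (μ : Vs X) : Val X := μ.1

theorem isEmbedding_toVal : Topology.IsEmbedding (toVal : Vs X → Val X) :=
  Topology.IsEmbedding.subtypeVal

/-- The simple valuation `∑ c(x) δ_x` of a finitely supported family of coefficients. -/
noncomputable def ofFinsupp (c : X →₀ ℝ≥0) : Vs X := ⟨c.sum fun x r => r • Val.dirac x, c, rfl⟩

/-- The unit `x ↦ δ_x` of the monad `𝒱_s`. -/
noncomputable def unit : C(X, Vs X) where
  toFun x := ⟨Val.dirac x, Finsupp.single x 1, by simp⟩
  continuous_toFun := Val.continuous_dirac.subtype_mk _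

theorem range_toVal : Set.range (toVal : Vs X → Val X) =
    ((Submodule.span ℝ≥0 (Set.range Val.dirac) : Submodule ℝ≥0 (Val X)) : Set (Val X)) := by
  ext μ
  rw [SetLike.mem_coe, Finsupp.mem_span_range_iff_exists_finsupp]
  constructor
  · rintro ⟨⟨μ, c, hc⟩, rfl⟩
    exact ⟨c, hc.symm⟩
  · rintro ⟨c, hc⟩
    exact ⟨⟨μ, c, hc.symm⟩, rfl⟩

end Vs

/-- The cone `𝒱_𝒦 X`: the smallest `𝒦`-subspace of the space of continuous valuations that
contains the simple valuations. It is a subcone of the cone of continuous valuations. -/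
def VK (𝒦 : KCategory.{u}) (X : Type u) [TopologicalSpace X] : Submodule ℝ≥0 (Val X) where
  carrier := 𝒦.cl (Set.range Vs.toVal)
  zero_mem' := 𝒦.subset_cl _ (by rw [Vs.range_toVal]; exact Submodule.zero_mem _)
  add_mem' := by
    have h1 : ∀ s ∈ Set.range (Vs.toVal : Vs X → Val X), ∀ ν ∈ 𝒦.cl (Set.range Vs.toVal),
        s + ν ∈ 𝒦.cl (Set.range (Vs.toVal : Vs X → Val X)) := by
      intro s hs
      refine 𝒦.mapsTo_cl (Val.continuous_const_add s) fun t ht => 𝒦.subset_cl _ ?_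
      rw [Vs.range_toVal] at hs ht ⊢
      exact Submodule.add_mem _ hs ht
    intro μ ν hμ hν
    refine 𝒦.mapsTo_cl (Val.continuous_const_add μ) (fun t ht => ?_) hν
    change μ + t ∈ _
    rw [add_comm]
    exact h1 t ht μ hμ
  smul_mem' := by
    intro r μ hμ
    refine 𝒦.mapsTo_cl (Val.continuous_const_smul r) (fun t ht => 𝒦.subset_cl _ ?_) hμ
    rw [Vs.range_toVal] at ht ⊢
    exact Submodule.smul_mem _ r ht

namespace Kc

variable (𝒦 : KCategory.{u}) (X : Type u) [TopologicalSpace X]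

/-- The continuous extension of the inclusion of the simple valuations into the sober space of
continuous valuations to the sobrification. -/
noncomputable def sobVs : Sob (Vs X) → Val X := Sob.extend Vs.toVal Vs.isEmbedding_toVal.continuous

/-- The embedding `sobVs` maps the `𝒦`-completion of `𝒱_s X` onto `𝒱_𝒦 X`. -/
theorem image_sobVs :
    sobVs X '' 𝒦.cl (Set.range Sob.unit) = 𝒦.cl (Set.range (Vs.toVal : Vs X → Val X)) := by
  have hemb : Topology.IsEmbedding (sobVs X) :=
    Sob.isEmbedding_extend _ Vs.isEmbedding_toVal.isInducing
  have hunit : ∀ s : Vs X, sobVs X (Sob.unit s) = s.toVal := fun s => Sob.extend_unit _ s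
  refine Set.Subset.antisymm (Set.mapsTo_iff_image_subset.1 ?_) (𝒦.cl_subset ?_ ?_)
  · refine 𝒦.mapsTo_cl hemb.continuous ?_
    rintro _ ⟨s, rfl⟩
    exact 𝒦.subset_cl _ ⟨s, (hunit s).symm⟩
  · rintro _ ⟨s, rfl⟩
    exact ⟨_, 𝒦.subset_cl _ ⟨s, rfl⟩, hunit s⟩
  · exact 𝒦.of_homeomorph _ _ ⟨hemb.homeomorphImage _⟩ (𝒦.isKSpace_cl _)

/-- The identification of the `𝒦`-completion of `𝒱_s X` with `𝒱_𝒦 X`: the homeomorphism that is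
the identity on simple valuations. -/
noncomputable def homeoVK : Kc 𝒦 (Vs X) ≃ₜ VK 𝒦 X :=
  ((Sob.isEmbedding_extend Vs.isEmbedding_toVal.continuous
    Vs.isEmbedding_toVal.isInducing).homeomorphImage _).trans
      (Homeomorph.setCongr (image_sobVs 𝒦 X))

theorem homeoVK_unit (s : Vs X) : (homeoVK 𝒦 X (unit 𝒦 s) : Val X) = s.toVal :=
  Sob.extend_unit Vs.isEmbedding_toVal.continuous s

/-- The cone structure of `𝒦_c (𝒱_s X) = 𝒱_𝒦 X`, inherited from the continuous valuations. -/
noncomputable instance : AddCommMonoid (Kc 𝒦 (Vs X)) := (homeoVK 𝒦 X).toEquiv.addCommMonoid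

noncomputable instance : Module ℝ≥0 (Kc 𝒦 (Vs X)) := (homeoVK 𝒦 X).toEquiv.module ℝ≥0

end Kc

/-! ### Cones -/

/-- A topological cone: a cone (a module over the semiring of nonnegative reals) with a `T₀`
topology for which addition and scalar multiplication are jointly continuous. The scalars carry
the Scott topology. -/
structure IsTopologicalCone (C : Type u) [AddCommMonoid C] [Module ℝ≥0 C] [TopologicalSpace C] :
    Prop where
  t0Space : T0Space C
  continuous_add : Continuous fun p : C × C => p.1 + p.2
  continuous_smul : Continuous fun p : Topology.WithScott ℝ≥0 × C =>
    Topology.WithScott.ofScott p.1 • p.2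

/-- Weak local convexity: every open neighbourhood of a point contains a convex (not necessarily
open) neighbourhood of the point. -/
def WeaklyLocallyConvex (C : Type u) [AddCommMonoid C] [Module ℝ≥0 C] [TopologicalSpace C] :
    Prop :=
  ∀ (x : C) (U : Set C), IsOpen U → x ∈ U → ∃ K ∈ 𝓝 x, Convex ℝ≥0 K ∧ K ⊆ U

/-- `α : 𝒱_s C → C` sends every simple valuation `∑ rᵢ δ_{xᵢ}` to its barycentre `∑ rᵢ xᵢ`. As
every simple valuation is of this form, there is at most one such map. -/
def IsBarycentreMap {C : Type u} [AddCommMonoid C] [Module ℝ≥0 C] [TopologicalSpace C]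
    (α : Vs C → C) : Prop :=
  ∀ c : C →₀ ℝ≥0, α (Vs.ofFinsupp c) = c.sum fun x r => r • x

section Functionals

variable {C : Type u} [AddCommMonoid C] [Module ℝ≥0 C] (f : C → ℝ≥0∞)

/-- `f (r a) = r f(a)`, with `0 * ∞ = 0`. -/
def IsHomogeneous : Prop := ∀ (r : ℝ≥0) (a : C), f (r • a) = (r : ℝ≥0∞) * f a

/-- `f (a + b) ≥ f a + f b`. -/
def IsSuperadditive : Prop := ∀ a b : C, f a + f b ≤ f (a + b)

/-- `f (a + b) ≤ f a + f b`. -/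
def IsSubadditive : Prop := ∀ a b : C, f (a + b) ≤ f a + f b

/-- `f (a + b) = f a + f b`. -/
def IsAdditive : Prop := ∀ a b : C, f (a + b) = f a + f b

/-- Homogeneous and superadditive. -/
def IsSuperlinearFunctional : Prop := IsHomogeneous f ∧ IsSuperadditive f

/-- Homogeneous and subadditive. -/
def IsSublinearFunctional : Prop := IsHomogeneous f ∧ IsSubadditive f

/-- Homogeneous and additive. -/
def IsLinearFunctional : Prop := IsHomogeneous f ∧ IsAdditive f

end Functionals

/-! The completion adds points but no open sets: an inclusion between open sets of `Kc 𝒦 X` can be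
tested on `X` (`Kc.subset_of_unit_mem`). Hence equality of continuous maps into `T₀` spaces, and
inequality of lower semicontinuous functions, need only be checked on `X`. The operations on `Kc 𝒦
C` are continuous in the points and extend those of `C`, so the cone axioms pass from `C` to `Kc 𝒦
C` one variable at a time. Homogeneity, superadditivity and subadditivity pass in the same way,
because both sides of each are lower semicontinuous.

The real work is the continuity of the barycentre map (`exists_isOpen_barycentre_mem`). If `∑ cᵢ xᵢ`
lies in an open set `U`, continuity of the operations, with Scott scalars, allows the positive
coefficients to be lowered strictly to `rᵢ` and the points to vary in neighbourhoods, which may be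
taken convex; let `Oᵢ` be their interiors. Requiring a simple valuation to give each union of the
`Oᵢ` with `i ∈ J`, `J` nonempty, mass greater than `∑_J rᵢ` is a weakly open condition, satisfied by
`∑ cᵢ δ_{xᵢ}`. It is also Hall's condition: by `exists_transport_of_sum_lt` the valuation splits
into portions of mass `rᵢ` carried by `Oᵢ`, and a surplus. Convexity replaces each portion by `rᵢ`
times one point near `xᵢ`, so the portions sum to a point of `U`; adding the surplus does not leave
`U`, since open sets of a cone are stable under addition of arbitrary elements. -/

/-! ### A fractional marriage theorem -/

/-- The fractional form of Hall's marriage theorem: demands `r i` can be met from supplies `s k`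
along the relation `R` if every nonempty set of demanders sees a supply exceeding its demand. -/
theorem exists_transport_of_sum_lt {ι κ : Type*} [Fintype ι] [Fintype κ]
    (r : ι → ℝ≥0) (s : κ → ℝ≥0) (R : ι → κ → Prop) [∀ i k, Decidable (R i k)]
    (h : ∀ J : Finset ι, J.Nonempty →
      ∑ i ∈ J, r i < ∑ k with (∃ i ∈ J, R i k), s k) :
    ∃ t : ι → κ → ℝ≥0, (∀ i, ∑ k, t i k = r i) ∧ (∀ k, ∑ i, t i k ≤ s k) ∧
      ∀ i k, t i k ≠ 0 → R i k := by
  classical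
  -- a common denominator `N` for which the rounded data satisfy Hall's condition
  have hN : ∃ N : ℕ, 0 < N ∧ ∀ J : Finset ι, J.Nonempty →
      ∑ i ∈ J, ⌈(N : ℝ≥0) * r i⌉₊ ≤ ∑ k with (∃ i ∈ J, R i k), ⌊(N : ℝ≥0) * s k⌋₊ := by
    have hJ : ∀ J : Finset ι, ∀ᶠ N : ℕ in Filter.atTop, J.Nonempty →
        ∑ i ∈ J, ⌈(N : ℝ≥0) * r i⌉₊ ≤ ∑ k with (∃ i ∈ J, R i k), ⌊(N : ℝ≥0) * s k⌋₊ := by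
      intro J
      by_cases hne : J.Nonempty
      swap
      · exact Filter.Eventually.of_forall fun N h' => absurd h' hne
      have hlt := h J hne
      set T : Finset κ := Finset.univ.filter fun k => ∃ i ∈ J, R i k with hT
      have hlt' : (0 : ℝ) < ∑ k ∈ T, (s k : ℝ) - ∑ i ∈ J, (r i : ℝ) := by
        rw [sub_pos]
        exact_mod_cast hlt
      -- The strict slack grows linearly in `N`, while rounding costs at most one unit per element
      -- of `J` and of `T`. Only finitely many `J` occur, so one `N` serves them all.
      have htend := (tendsto_natCast_atTop_atTop (R := ℝ)).atTop_mul_const hlt'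
      filter_upwards [htend.eventually_ge_atTop ((J.card : ℝ) + T.card)] with N hN _
      have h1 : ((∑ i ∈ J, ⌈(N : ℝ≥0) * r i⌉₊ : ℕ) : ℝ) ≤ ∑ i ∈ J, ((N : ℝ) * r i + 1) := by
        push_cast
        refine Finset.sum_le_sum fun i _ => ?_
        have := (Nat.ceil_lt_add_one (zero_le (a := (N : ℝ≥0) * r i))).le
        exact_mod_cast this
      have h2 : ∑ k ∈ T, ((N : ℝ) * s k - 1) ≤ ((∑ k ∈ T, ⌊(N : ℝ≥0) * s k⌋₊ : ℕ) : ℝ) := by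
        push_cast
        refine Finset.sum_le_sum fun k _ => ?_
        have := (Nat.lt_floor_add_one ((N : ℝ≥0) * s k)).le
        rw [sub_le_iff_le_add]
        exact_mod_cast this
      have h3 : ∑ i ∈ J, ((N : ℝ) * r i + 1) ≤ ∑ k ∈ T, ((N : ℝ) * s k - 1) := by
        simp only [Finset.sum_add_distrib, Finset.sum_sub_distrib, ← Finset.mul_sum,
          Finset.sum_const, nsmul_eq_mul, mul_one]
        rw [mul_sub] at hN
        linarith
      exact_mod_cast (h1.trans h3).trans h2
    obtain ⟨N, hN, hN0⟩ := ((Filter.eventually_all.2 hJ).and (Filter.eventually_gt_atTop 0)).exists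
    exact ⟨N, hN0, hN⟩
  obtain ⟨N, hN0, hN⟩ := hN
  set n : ι → ℕ := fun i => ⌈(N : ℝ≥0) * r i⌉₊ with hn
  set m : κ → ℕ := fun k => ⌊(N : ℝ≥0) * s k⌋₊ with hm
  have hN0' : (0 : ℝ≥0) < N := by exact_mod_cast hN0
  -- Integral Hall theorem for `n i` unit tokens of demand and `m k` unit tokens of supply.
  -- Enlarging a set of demand tokens to full fibres does not change the supply it sees, so it
  -- suffices to test sets of indices `J`.
  obtain ⟨f, hf, hfR⟩ := (Finset.all_card_le_biUnion_card_iff_exists_injective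
    (fun a : Σ i, Fin (n i) =>
      (Finset.univ.filter fun b : Σ k, Fin (m k) => R a.1 b.1))).1 (by
    intro S
    rcases S.eq_empty_or_nonempty with rfl | hS
    · simp
    have h1 : S ⊆ (S.image Sigma.fst).sigma fun i => (Finset.univ : Finset (Fin (n i))) := by
      intro a ha
      simpa using ⟨a.2, ha⟩
    have h2 : (Finset.univ.filter fun k => ∃ i ∈ S.image Sigma.fst, R i k).sigma
        (fun k => (Finset.univ : Finset (Fin (m k)))) ⊆ S.biUnion fun a : Σ i, Fin (n i) =>
          (Finset.univ.filter fun b : Σ k, Fin (m k) => R a.1 b.1) := by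
      intro b hb
      simp only [Finset.mem_sigma, Finset.mem_filter, Finset.mem_univ, true_and, and_true,
        Finset.mem_image, Finset.mem_biUnion] at hb ⊢
      obtain ⟨_, ⟨a, ha, rfl⟩, hR⟩ := hb
      exact ⟨a, ha, hR⟩
    refine (Finset.card_le_card h1).trans (le_trans ?_ (Finset.card_le_card h2))
    simpa [Finset.card_sigma] using hN _ (hS.image Sigma.fst))
  let T : ι → κ → ℕ := fun i k =>
    (Finset.univ.filter fun a : Σ i, Fin (n i) => a.1 = i ∧ (f a).1 = k).card
  have hrow : ∀ i, ∑ k, T i k = n i := by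
    intro i
    have h1 : (Finset.univ.filter fun a : Σ i, Fin (n i) => a.1 = i).card = n i := by
      have : (Finset.univ.filter fun a : Σ i, Fin (n i) => a.1 = i) =
          ({i} : Finset ι).sigma fun i => (Finset.univ : Finset (Fin (n i))) := by
        ext a
        simp
      rw [this]
      simp [Finset.card_sigma]
    rw [← h1, Finset.card_eq_sum_card_fiberwise (f := fun a => (f a).1) (t := Finset.univ)
      fun _ _ => by simp]
    simp [T, Finset.filter_filter]
  have hcol : ∀ k, ∑ i, T i k ≤ m k := by
    intro k
    have h1 : (Finset.univ.filter fun a : Σ i, Fin (n i) => (f a).1 = k).card ≤ m k := by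
      have : (Finset.univ.filter fun a : Σ i, Fin (n i) => (f a).1 = k).image f ⊆
          ({k} : Finset κ).sigma fun k => (Finset.univ : Finset (Fin (m k))) := by
        intro b hb
        simp only [Finset.mem_image, Finset.mem_filter, Finset.mem_univ, true_and] at hb
        obtain ⟨a, ha, rfl⟩ := hb
        simpa using ha
      have := Finset.card_le_card this
      rw [Finset.card_image_of_injective _ hf] at this
      simpa [Finset.card_sigma] using this
    refine le_trans (le_of_eq ?_) h1
    rw [Finset.card_eq_sum_card_fiberwise (f := fun a => a.1) (t := Finset.univ)
      fun _ _ => by simp]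
    simp [T, Finset.filter_filter, and_comm]
  -- A token of demander `i` is worth `r i / n i` rather than `1 / N`, so that demands are met
  -- exactly; rounding demand up makes this worth at most `1 / N`, which keeps the supplies
  -- sufficient.
  have hrn : ∀ i, r i / n i ≤ (N : ℝ≥0)⁻¹ := by
    intro i
    refine div_le_of_le_mul₀ zero_le zero_le ?_
    rw [← div_eq_inv_mul, le_div_iff₀ hN0', mul_comm]
    exact Nat.le_ceil _
  refine ⟨fun i k => T i k * (r i / n i), fun i => ?_, fun k => ?_, fun i k hik => ?_⟩
  · rw [← Finset.sum_mul, ← Nat.cast_sum, hrow]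
    -- Here the token value is the default `r i / 0 = 0`, which is correct since `r i = 0`.
    by_cases hi : n i = 0
    · have : (N : ℝ≥0) * r i ≤ 0 := by
        have h0 := Nat.le_ceil ((N : ℝ≥0) * r i)
        rwa [show ⌈(N : ℝ≥0) * r i⌉₊ = 0 from hi, Nat.cast_zero] at h0
      have hr : r i = 0 := by
        rcases mul_eq_zero.1 (le_antisymm this zero_le) with h0 | h0
        · exact absurd h0 hN0'.ne'
        · exact h0
      simp [hr]
    · exact mul_div_cancel₀ _ (by exact_mod_cast hi)
  · calc ∑ i, (T i k : ℝ≥0) * (r i / n i) ≤ ∑ i, (T i k : ℝ≥0) * (N : ℝ≥0)⁻¹ :=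
          Finset.sum_le_sum fun i _ => mul_le_mul_right (hrn i) _
      _ = ((∑ i, T i k : ℕ) : ℝ≥0) / N := by
          rw [← Finset.sum_mul, Nat.cast_sum, div_eq_mul_inv]
      _ ≤ s k := by
          rw [div_le_iff₀ hN0', mul_comm]
          exact le_trans (by exact_mod_cast hcol k) (Nat.floor_le zero_le)
  · have hT : T i k ≠ 0 := fun h0 => hik (by simp [h0])
    obtain ⟨a, ha⟩ := Finset.card_ne_zero.1 hT
    simp only [Finset.mem_filter, Finset.mem_univ, true_and] at ha
    obtain ⟨rfl, rfl⟩ := ha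
    simpa using hfR a

/-! ### Convex sets in cones -/

/-- The point is the weighted average. Nonemptiness of `K` covers total weight zero, where any point
will do; points of weight zero may lie outside `K`. -/
theorem Convex.exists_mem_sum_smul_eq {C κ : Type*} [AddCommMonoid C] [Module ℝ≥0 C]
    {K : Set C} (hK : Convex ℝ≥0 K) (hne : K.Nonempty) (s : Finset κ) (w : κ → ℝ≥0) (y : κ → C)
    (h : ∀ k ∈ s, w k ≠ 0 → y k ∈ K) :
    ∃ z ∈ K, ∑ k ∈ s, w k • y k = (∑ k ∈ s, w k) • z := by
  classical
  induction s using Finset.induction_on with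
  | empty =>
    obtain ⟨z, hz⟩ := hne
    exact ⟨z, hz, by simp⟩
  | insert a s ha ih =>
    obtain ⟨z, hz, hsum⟩ := ih fun k hk => h k (Finset.mem_insert_of_mem hk)
    rw [Finset.sum_insert ha, Finset.sum_insert ha, hsum]
    by_cases h0 : w a = 0
    · exact ⟨z, hz, by simp [h0]⟩
    have ht : w a + ∑ k ∈ s, w k ≠ 0 := fun h' => h0 (by simpa using (add_eq_zero.1 h').1)
    refine ⟨(w a / (w a + ∑ k ∈ s, w k)) • y a +
      ((∑ k ∈ s, w k) / (w a + ∑ k ∈ s, w k)) • z,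
      hK (h a (Finset.mem_insert_self _ _) h0) hz zero_le zero_le ?_, ?_⟩
    · rw [← add_div, div_self ht]
    · rw [smul_add, smul_smul, smul_smul, mul_div_cancel₀ _ ht, mul_div_cancel₀ _ ht]

/-! ### Topological cones -/

namespace IsTopologicalCone

variable {C : Type u} [AddCommMonoid C] [Module ℝ≥0 C] [TopologicalSpace C]

/-- Scott open sets of scalars are upper sets: along `r ↦ a + r • b`, membership in `U` at `0`
forces membership at `1`. -/
theorem mem_add_of_mem (hC : IsTopologicalCone C) {U : Set C} (hU : IsOpen U) {a : C} (b : C)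
    (ha : a ∈ U) : a + b ∈ U := by
  have hcont : Continuous fun r : Topology.WithScott ℝ≥0 =>
      a + Topology.WithScott.ofScott r • b :=
    hC.continuous_add.comp (continuous_const.prodMk
      (hC.continuous_smul.comp (continuous_id.prodMk continuous_const)))
  have hup := Topology.IsScott.isUpperSet_of_isOpen (D := Set.univ) (hU.preimage hcont)
  have h0 : Topology.WithScott.toScott (0 : ℝ≥0) ∈
      (fun r : Topology.WithScott ℝ≥0 => a + Topology.WithScott.ofScott r • b) ⁻¹' U := by
    simpa using ha
  have h1 : Topology.WithScott.toScott (0 : ℝ≥0) ≤ Topology.WithScott.toScott (1 : ℝ≥0) :=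
    zero_le_one (α := ℝ≥0)
  simpa using hup h1 h0

/-- A nonzero `r` is the directed supremum of the scalars strictly below it; for `r = 0` there are
none. -/
theorem exists_lt_mem_scott {O : Set (Topology.WithScott ℝ≥0)} (hO : IsOpen O) {r : ℝ≥0}
    (hr : r ≠ 0) (h : Topology.WithScott.toScott r ∈ O) :
    ∃ r' < r, Topology.WithScott.toScott r' ∈ O := by
  have h2 := (Topology.IsScott.isOpen_iff_isUpperSet_and_dirSupInaccOn
    (D := Set.univ)).1 hO |>.2
  have hlub : IsLUB (Set.Iio r) r := ⟨fun _ h => h.le, fun b hb => le_of_forall_lt_imp_le_of_dense fun c hc => hb hc⟩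
  have hdir : DirectedOn (· ≤ ·) (Set.Iio r) := fun a ha b hb =>
    ⟨max a b, Set.mem_Iio.2 (max_lt ha hb), le_max_left _ _, le_max_right _ _⟩
  obtain ⟨r', hr', hr'O⟩ := h2 (Set.mem_univ (Set.Iio r))
    ⟨(0 : ℝ≥0), pos_iff_ne_zero.2 hr⟩ hdir hlub h
  exact ⟨r', hr', hr'O⟩

theorem exists_sum_smul_mem (hC : IsTopologicalCone C) {ι : Type*} [Fintype ι] (r : ι → ℝ≥0)
    (hr : ∀ i, r i ≠ 0) (x : ι → C) {U : Set C} (hU : IsOpen U) (h : ∑ i, r i • x i ∈ U) :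
    ∃ (r' : ι → ℝ≥0) (V : ι → Set C), (∀ i, r' i < r i) ∧ (∀ i, IsOpen (V i) ∧ x i ∈ V i) ∧
      ∀ y : ι → C, (∀ i, y i ∈ V i) → ∑ i, r' i • y i ∈ U := by
  have : ContinuousAdd C := ⟨hC.continuous_add⟩
  have hcont : Continuous fun p : ι → Topology.WithScott ℝ≥0 × C =>
      ∑ i, Topology.WithScott.ofScott (p i).1 • (p i).2 :=
    continuous_finsetSum _ fun i _ => hC.continuous_smul.comp (continuous_apply i)
  obtain ⟨u, hu, huU⟩ := isOpen_pi_iff'.1 (hU.preimage hcont)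
    (fun i => (Topology.WithScott.toScott (r i), x i)) h
  have hi : ∀ i, ∃ r' < r i, ∃ V : Set C, IsOpen V ∧ x i ∈ V ∧
      ∀ y ∈ V, (Topology.WithScott.toScott r', y) ∈ u i := by
    intro i
    obtain ⟨O, V, hO, hV, hrO, hxV, hsub⟩ := isOpen_prod_iff.1 (hu i).1 _ _ (hu i).2
    obtain ⟨r', hr', hr'O⟩ := exists_lt_mem_scott hO (hr i) hrO
    exact ⟨r', hr', V, hV, hxV, fun y hy => hsub ⟨hr'O, hy⟩⟩
  choose r' hr' V hV hxV hsub using hi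
  refine ⟨r', V, hr', fun i => ⟨hV i, hxV i⟩, fun y hy => ?_⟩
  exact huU (show (fun i => (Topology.WithScott.toScott (r' i), y i)) ∈ Set.univ.pi u from
    fun i _ => hsub i _ (hy i))

end IsTopologicalCone

/-! ### The barycentre map -/

namespace Vs

variable {X : Type u} [TopologicalSpace X]

open Classical in
theorem toVal_ofFinsupp_apply (c : X →₀ ℝ≥0) (U : TopologicalSpace.Opens X) :
    (ofFinsupp c).toVal U = ((∑ x : c.support with x.1 ∈ U, c x.1 : ℝ≥0) : ℝ≥0∞) := by
  have h1 : (ofFinsupp c).toVal U = ∑ x ∈ c.support, (c x : ℝ≥0∞) * Val.dirac x U := by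
    have h := congrFun (map_sum Val.evalHom (fun x => c x • Val.dirac x) c.support) U
    rw [Finset.sum_apply] at h
    exact h
  rw [h1, Finset.sum_filter, ← Finset.sum_coe_sort, ENNReal.ofNNReal_finsetSum]
  refine Finset.sum_congr rfl fun x _ => ?_
  by_cases hx : x.1 ∈ U <;> simp [Val.dirac, hx]

theorem exists_ofFinsupp_eq (μ : Vs X) : ∃ c, ofFinsupp c = μ := by
  obtain ⟨μ, c, hc⟩ := μ
  exact ⟨c, Subtype.ext hc.symm⟩

end Vs

section Barycentre

variable {C : Type u} [AddCommMonoid C] [Module ℝ≥0 C] [TopologicalSpace C]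

/-- Valuations close to `∑ r i δ_{x i}` have barycentres close to `∑ r i • x i`. -/
theorem exists_isOpen_barycentre_mem (hC : IsTopologicalCone C) (hC' : WeaklyLocallyConvex C)
    {U : Set C} (hU : IsOpen U) (c : C →₀ ℝ≥0) (hc : (c.sum fun x r => r • x) ∈ U) :
    ∃ W : Set (Vs C), IsOpen W ∧ Vs.ofFinsupp c ∈ W ∧
      ∀ d : C →₀ ℝ≥0, Vs.ofFinsupp d ∈ W → (d.sum fun x r => r • x) ∈ U := by
  classical
  rw [Finsupp.sum, ← Finset.sum_coe_sort] at hc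
  -- Indexing by the support makes every coefficient nonzero, so each can be lowered strictly; this
  -- provides the strict inequalities in `W`.
  obtain ⟨r, V, hr, hV, hVU⟩ := hC.exists_sum_smul_mem (fun i : c.support => c i.1)
    (fun i => Finsupp.mem_support_iff.1 i.2) (fun i => i.1) hU hc
  choose K hK hKconv hKV using fun i => hC' i.1 (V i) (hV i).1 (hV i).2
  let O : c.support → TopologicalSpace.Opens C := fun i => ⟨interior (K i), isOpen_interior⟩
  let G : Finset c.support → TopologicalSpace.Opens C := fun J => ⨆ i ∈ J, O i
  have hG : ∀ J x, x ∈ G J ↔ ∃ i ∈ J, x ∈ O i := fun J x => by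
    simp [G]
  let W : Set (Vs C) := ⋂ J ∈ (Finset.univ.filter fun J : Finset c.support => J.Nonempty),
    Vs.toVal ⁻¹' {ν | ((∑ i ∈ J, r i : ℝ≥0) : ℝ≥0∞) < ν (G J)}
  have hW : ∀ d : C →₀ ℝ≥0, Vs.ofFinsupp d ∈ W ↔ ∀ J : Finset c.support, J.Nonempty →
      ∑ i ∈ J, r i < ∑ k : d.support with (∃ i ∈ J, k.1 ∈ O i), d k.1 := by
    intro d
    simp only [W, Set.mem_iInter, Finset.mem_filter, Finset.mem_univ, true_and, Set.mem_preimage,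
      Set.mem_ofPred_eq, Vs.toVal_ofFinsupp_apply, ENNReal.coe_lt_coe, hG]
  refine ⟨W, ?_, ?_, ?_⟩
  · exact isOpen_biInter_finset fun J _ =>
      (Val.isOpen_basic _ _).preimage Vs.isEmbedding_toVal.continuous
  · rw [hW]
    intro J hJ
    refine lt_of_lt_of_le (Finset.sum_lt_sum_of_nonempty hJ fun i _ => hr i)
      (Finset.sum_le_sum_of_subset fun i hi => ?_)
    rw [Finset.mem_filter]
    exact ⟨Finset.mem_univ _, i, hi, mem_interior_iff_mem_nhds.2 (hK i)⟩
  · intro d hd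
    obtain ⟨t, htr, hts, htO⟩ := exists_transport_of_sum_lt r (fun k : d.support => d k.1)
      (fun i k => k.1 ∈ O i) ((hW d).1 hd)
    choose z hzK hz using fun i => (hKconv i).exists_mem_sum_smul_eq
      ⟨i.1, mem_of_mem_nhds (hK i)⟩ Finset.univ (t i) (fun k : d.support => k.1)
      fun k _ hk => interior_subset (htO i k hk)
    have hmem : ∑ i, r i • z i ∈ U := hVU z fun i => hKV i (hzK i)
    -- Transported portions plus the unused mass at each point; `hts` makes the truncated
    -- subtraction exact.
    have hsum : (d.sum fun x r => r • x) =
        ∑ i, r i • z i + ∑ k : d.support, (d k.1 - ∑ i, t i k) • k.1 := by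
      simp_rw [← htr, ← hz]
      rw [Finset.sum_comm, ← Finset.sum_add_distrib, Finsupp.sum, ← Finset.sum_coe_sort]
      refine Finset.sum_congr rfl fun k _ => ?_
      rw [← Finset.sum_smul, ← add_smul, add_tsub_cancel_of_le (hts k)]
    rw [hsum]
    exact hC.mem_add_of_mem hU _ hmem

theorem exists_continuous_isBarycentreMap (hC : IsTopologicalCone C)
    (hC' : WeaklyLocallyConvex C) : ∃ α : C(Vs C, C), IsBarycentreMap α := by
  have := hC.t0Space
  choose φ hφ using Vs.exists_ofFinsupp_eq (X := C)
  let α : Vs C → C := fun μ => (φ μ).sum fun x r => r • x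
  have hα : IsBarycentreMap α := by
    intro c
    -- Two representations of one simple valuation have barycentres in the same open sets, hence
    -- equal ones by `T₀`: the choice `φ` is harmless.
    have h : ∀ c d : C →₀ ℝ≥0, Vs.ofFinsupp c = Vs.ofFinsupp d → ∀ U : Set C, IsOpen U →
        (c.sum fun x r => r • x) ∈ U → (d.sum fun x r => r • x) ∈ U := by
      intro c d hcd U hU hcU
      obtain ⟨W, -, hcW, hW⟩ := exists_isOpen_barycentre_mem hC hC' hU c hcU
      exact hW d (hcd ▸ hcW)
    exact (inseparable_iff_forall_isOpen.2 fun U hU =>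
      ⟨h _ _ (hφ _) U hU, h _ _ (hφ _).symm U hU⟩).eq
  refine ⟨⟨α, continuous_iff_continuousAt.2 fun μ => ?_⟩, hα⟩
  rw [ContinuousAt, (nhds_basis_opens (α μ)).tendsto_right_iff]
  rintro U ⟨hμU, hU⟩
  obtain ⟨W, hW, hμW, hWU⟩ := exists_isOpen_barycentre_mem hC hC' hU (φ μ) hμU
  rw [hφ] at hμW
  filter_upwards [hW.mem_nhds hμW] with ν hν
  exact hWU _ (by rwa [hφ])

end Barycentre

theorem Finsupp.sum_single_add_single_smul {X M : Type*} [AddCommMonoid M] [Module ℝ≥0 M]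
    (v : X → M) (a b : X) :
    ((Finsupp.single a 1 + Finsupp.single b 1 : X →₀ ℝ≥0).sum fun x r => r • v x) = v a + v b := by
  classical
  rw [Finsupp.sum_add_index' (h := fun x r => r • v x) (fun _ => zero_smul _ _)
    (fun _ _ _ => add_smul _ _ _)]
  simp

namespace Kc

variable {𝒦 : KCategory.{u}} {X : Type u} [TopologicalSpace X]

/-! ### Extension of maps to the `𝒦`-completion -/

/-- Open sets are traces of `Sob.meets U`, and `U` is recovered as the set of `x` whose unit lies in
it. This is stronger than density of `X`. -/
theorem subset_of_unit_mem {S T : Set (Kc 𝒦 X)} (hS : IsOpen S) (hT : IsOpen T)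
    (h : ∀ x : X, unit 𝒦 x ∈ S → unit 𝒦 x ∈ T) : S ⊆ T := by
  obtain ⟨_, ⟨U, hU, rfl⟩, rfl⟩ := isOpen_induced_iff.1 hS
  obtain ⟨_, ⟨V, hV, rfl⟩, rfl⟩ := isOpen_induced_iff.1 hT
  rintro A ⟨x, hxA, hxU⟩
  exact ⟨x, hxA, (Sob.unit_mem_meets hV x).1 (h x ((Sob.unit_mem_meets hU x).2 hxU))⟩

theorem eq_of_continuous_of_unit {Z : Type*} [TopologicalSpace Z] [T0Space Z] {f g : Kc 𝒦 X → Z}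
    (hf : Continuous f) (hg : Continuous g) (h : ∀ x, f (unit 𝒦 x) = g (unit 𝒦 x))
    (A : Kc 𝒦 X) : f A = g A := by
  refine (inseparable_iff_forall_isOpen.2 fun U hU => ⟨?_, ?_⟩).eq
  · exact fun hA => subset_of_unit_mem (hU.preimage hf) (hU.preimage hg)
      (fun x hx => by simpa only [Set.mem_preimage, h] using hx) hA
  · exact fun hA => subset_of_unit_mem (hU.preimage hg) (hU.preimage hf)
      (fun x hx => by simpa only [Set.mem_preimage, h] using hx) hA

theorem le_of_lsc_of_unit {f g : Kc 𝒦 X → ℝ≥0∞} (hf : LowerSemicontinuous f)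
    (hg : LowerSemicontinuous g) (h : ∀ x, f (unit 𝒦 x) ≤ g (unit 𝒦 x)) (A : Kc 𝒦 X) :
    f A ≤ g A :=
  le_of_forall_lt fun r hr => subset_of_unit_mem (hf.isOpen_preimage r) (hg.isOpen_preimage r)
    (fun x hx => lt_of_lt_of_le hx (h x)) hr

/-- The lower semicontinuous extension of `f` to the `𝒦`-completion. -/
noncomputable def lscExtend (f : X → ℝ≥0∞) (A : Kc 𝒦 X) : ℝ≥0∞ := ⨆ x ∈ Sob.carrier A.1, f x

/-- Superlevel sets of the extension are those induced by the superlevel sets of `f`; both its lower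
semicontinuity and its agreement with `f` on `X` follow. -/
theorem lt_lscExtend_iff {f : X → ℝ≥0∞} {r : ℝ≥0∞} {A : Kc 𝒦 X} :
    r < lscExtend f A ↔ A.1 ∈ Sob.meets (f ⁻¹' Set.Ioi r) := by
  simp only [lscExtend, lt_iSup_iff, exists_prop]
  rfl

theorem lowerSemicontinuous_lscExtend {f : X → ℝ≥0∞} (hf : LowerSemicontinuous f) :
    LowerSemicontinuous (lscExtend f : Kc 𝒦 X → ℝ≥0∞) := by
  refine lowerSemicontinuous_iff_isOpen_preimage.2 fun r => isOpen_induced_iff.2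
    ⟨_, Sob.isOpen_meets (hf.isOpen_preimage r), ?_⟩
  exact Set.ext fun A : Kc 𝒦 X => lt_lscExtend_iff.symm

theorem lscExtend_unit {f : X → ℝ≥0∞} (hf : LowerSemicontinuous f) (x : X) :
    lscExtend f (unit 𝒦 x) = f x :=
  eq_of_forall_lt_iff fun r =>
    lt_lscExtend_iff.trans (Sob.unit_mem_meets (hf.isOpen_preimage r) x)

instance : T0Space (Kc 𝒦 X) := inferInstanceAs (T0Space ↥(𝒦.cl (Set.range Sob.unit)))

/-! ### Simple valuations -/

/-- The homeomorphism with `𝒱_𝒦 X`, followed by the inclusion into the continuous valuations. -/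
noncomputable def toVal (A : Kc 𝒦 (Vs X)) : Val X := homeoVK 𝒦 X A

theorem isEmbedding_toVal : Topology.IsEmbedding (toVal : Kc 𝒦 (Vs X) → Val X) :=
  Topology.IsEmbedding.subtypeVal.comp (homeoVK 𝒦 X).isEmbedding

theorem toVal_unit (s : Vs X) : toVal (unit 𝒦 s) = s.toVal := homeoVK_unit 𝒦 X s

theorem toVal_add (A B : Kc 𝒦 (Vs X)) : toVal (A + B) = toVal A + toVal B :=
  congrArg Subtype.val ((homeoVK 𝒦 X).apply_symm_apply _)

theorem toVal_smul (r : ℝ≥0) (A : Kc 𝒦 (Vs X)) : toVal (r • A) = r • toVal A :=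
  congrArg Subtype.val ((homeoVK 𝒦 X).apply_symm_apply _)

theorem continuous_add_vs : Continuous fun p : Kc 𝒦 (Vs X) × Kc 𝒦 (Vs X) => p.1 + p.2 := by
  refine isEmbedding_toVal.continuous_iff.2 (Val.continuous_of_lsc fun U => ?_)
  have h : ∀ p : Kc 𝒦 (Vs X) × Kc 𝒦 (Vs X),
      toVal (p.1 + p.2) U = toVal p.1 U + toVal p.2 U := fun p => by
    rw [toVal_add]
    rfl
  simp only [Function.comp_def, h]
  exact ((Val.lsc_apply U).comp (isEmbedding_toVal.continuous.comp continuous_fst)).add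
    ((Val.lsc_apply U).comp (isEmbedding_toVal.continuous.comp continuous_snd))

theorem continuous_const_smul_vs (r : ℝ≥0) : Continuous fun A : Kc 𝒦 (Vs X) => r • A := by
  refine isEmbedding_toVal.continuous_iff.2 ?_
  simp only [Function.comp_def, toVal_smul]
  exact (Val.continuous_const_smul r).comp isEmbedding_toVal.continuous

/-! ### The cone structure of the `𝒦`-completion -/

section Cone

variable {C : Type u} [TopologicalSpace C]

/-- The extension of the addition of `C` to its `𝒦`-completion. -/
noncomputable def add (α : C(Vs C, C)) (x y : Kc 𝒦 C) : Kc 𝒦 C :=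
  map 𝒦 α (map 𝒦 Vs.unit x + map 𝒦 Vs.unit y)

/-- The extension of the scalar multiplication of `C` to its `𝒦`-completion. -/
noncomputable def smul (α : C(Vs C, C)) (r : ℝ≥0) (x : Kc 𝒦 C) : Kc 𝒦 C :=
  map 𝒦 α (r • map 𝒦 Vs.unit x)

variable {α : C(Vs C, C)}

/-- Joint continuity is needed when a variable occurs in both summands, as in `(r + s) • x = r • x +
s • x`. -/
theorem continuous_add {Y : Type*} [TopologicalSpace Y] {f g : Y → Kc 𝒦 C} (hf : Continuous f)
    (hg : Continuous g) : Continuous fun y => add α (f y) (g y) :=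
  have h := continuous_add_vs.comp
    (((continuous_map 𝒦 Vs.unit).comp hf).prodMk ((continuous_map 𝒦 Vs.unit).comp hg))
  (continuous_map 𝒦 α).comp h

theorem continuous_smul {Y : Type*} [TopologicalSpace Y] {f : Y → Kc 𝒦 C} (r : ℝ≥0)
    (hf : Continuous f) : Continuous fun y => smul α r (f y) :=
  (continuous_map 𝒦 α).comp ((continuous_const_smul_vs r).comp
    ((continuous_map 𝒦 Vs.unit).comp hf))

variable [AddCommMonoid C] [Module ℝ≥0 C]

/-- On `C` the formula gives the barycentre of the simple valuation `δ_a + δ_b`; writing its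
coefficients as a sum of two `Finsupp.single` also covers `a = b`. -/
theorem add_unit (hα : IsBarycentreMap α) (a b : C) :
    add α (unit 𝒦 a) (unit 𝒦 b) = unit 𝒦 (a + b) := by
  have h : unit 𝒦 (Vs.unit a) + unit 𝒦 (Vs.unit b) =
      unit 𝒦 (Vs.ofFinsupp (Finsupp.single a 1 + Finsupp.single b 1)) := by
    refine isEmbedding_toVal.injective ?_
    rw [toVal_add, toVal_unit, toVal_unit, toVal_unit]
    change Val.dirac a + Val.dirac b =
      Finsupp.sum (Finsupp.single a 1 + Finsupp.single b 1) fun x r => r • Val.dirac x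
    rw [Finsupp.sum_single_add_single_smul Val.dirac]
  rw [add, map_unit, map_unit, h, map_unit, hα,
    Finsupp.sum_single_add_single_smul fun x => x]

theorem smul_unit (hα : IsBarycentreMap α) (r : ℝ≥0) (a : C) :
    smul α r (unit 𝒦 a) = unit 𝒦 (r • a) := by
  have h : r • unit 𝒦 (Vs.unit a) = unit 𝒦 (Vs.ofFinsupp (Finsupp.single a r)) := by
    refine isEmbedding_toVal.injective ?_
    rw [toVal_smul, toVal_unit, toVal_unit]
    change r • Val.dirac a = (Finsupp.single a r).sum fun x r => r • Val.dirac x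
    simp
  rw [smul, map_unit, h, map_unit, hα]
  simp

/-- The `𝒦`-completion of a cone as an additive commutative monoid. -/
noncomputable abbrev addCommMonoidOfBarycentre (hα : IsBarycentreMap α) :
    AddCommMonoid (Kc 𝒦 C) where
  add := add α
  zero := unit 𝒦 0
  add_assoc x y z := by
    change add α (add α x y) z = add α x (add α y z)
    -- One variable at a time: with `y` and `z` arbitrary in the completion, `x` may be taken in
    -- `C`; then `y`, then `z`.
    revert x
    refine eq_of_continuous_of_unit (continuous_add (continuous_add continuous_id continuous_const)
      continuous_const) (continuous_add continuous_id continuous_const) fun a => ?_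
    revert y
    refine eq_of_continuous_of_unit (continuous_add (continuous_add continuous_const continuous_id)
      continuous_const) (continuous_add continuous_const (continuous_add continuous_id
      continuous_const)) fun b => ?_
    revert z
    refine eq_of_continuous_of_unit (continuous_add continuous_const continuous_id)
      (continuous_add continuous_const (continuous_add continuous_const continuous_id)) fun c => ?_
    simp only [add_unit hα, add_assoc]
  zero_add := by
    change ∀ x, add α (unit 𝒦 0) x = x
    exact eq_of_continuous_of_unit (continuous_add continuous_const continuous_id) continuous_id
      fun a => by rw [add_unit hα, zero_add]
  add_zero := by
    change ∀ x, add α x (unit 𝒦 0) = x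
    exact eq_of_continuous_of_unit (continuous_add continuous_id continuous_const) continuous_id
      fun a => by rw [add_unit hα, add_zero]
  add_comm x y := congrArg (map 𝒦 α) (add_comm _ _)
  nsmul n x := @nsmulRec _ ⟨unit 𝒦 0⟩ ⟨add α⟩ n x
  nsmul_zero _ := rfl
  nsmul_succ _ _ := rfl

/-- The `𝒦`-completion of a cone as a cone. -/
noncomputable abbrev moduleOfBarycentre (hα : IsBarycentreMap α) :
    letI := addCommMonoidOfBarycentre (𝒦 := 𝒦) hα
    Module ℝ≥0 (Kc 𝒦 C) :=
  letI := addCommMonoidOfBarycentre (𝒦 := 𝒦) hα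
  { smul := smul α
    one_smul := by
      change ∀ x, smul α 1 x = x
      exact eq_of_continuous_of_unit (continuous_smul 1 continuous_id) continuous_id
        fun a => by rw [smul_unit hα, one_smul]
    mul_smul := fun r s => by
      change ∀ x, smul α (r * s) x = smul α r (smul α s x)
      exact eq_of_continuous_of_unit (continuous_smul _ continuous_id)
        (continuous_smul _ (continuous_smul _ continuous_id))
        fun a => by simp only [smul_unit hα, mul_smul]
    smul_zero := fun r => by
      change smul α r (unit 𝒦 0) = unit 𝒦 0
      rw [smul_unit hα, smul_zero]
    smul_add := fun r x y => by
      change smul α r (add α x y) = add α (smul α r x) (smul α r y)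
      revert x
      refine eq_of_continuous_of_unit (continuous_smul r (continuous_add continuous_id
        continuous_const)) (continuous_add (continuous_smul r continuous_id) continuous_const)
        fun a => ?_
      revert y
      refine eq_of_continuous_of_unit (continuous_smul r (continuous_add continuous_const
        continuous_id)) (continuous_add continuous_const (continuous_smul r continuous_id))
        fun b => ?_
      simp only [smul_unit hα, add_unit hα, smul_add]
    add_smul := fun r s => by
      change ∀ x, smul α (r + s) x = add α (smul α r x) (smul α s x)
      exact eq_of_continuous_of_unit (continuous_smul _ continuous_id)
        (continuous_add (continuous_smul r continuous_id) (continuous_smul s continuous_id))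
        fun a => by simp only [smul_unit hα, add_unit hα, add_smul]
    zero_smul := by
      change ∀ x, smul α 0 x = unit 𝒦 0
      exact eq_of_continuous_of_unit (continuous_smul _ continuous_id) continuous_const
        fun a => by rw [smul_unit hα, zero_smul] }

/-! ### Functionals on the `𝒦`-completion -/

theorem _root_.LowerSemicontinuous.ennreal_const_mul {Y : Type*} [TopologicalSpace Y]
    {f : Y → ℝ≥0∞} (hf : LowerSemicontinuous f) (r : ℝ≥0) :
    LowerSemicontinuous fun y => (r : ℝ≥0∞) * f y :=
  (ENNReal.continuous_const_mul ENNReal.coe_ne_top).comp_lowerSemicontinuous hf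
    fun _ _ h => mul_le_mul_right h _

variable {f : C → ℝ≥0∞} {g : Kc 𝒦 C → ℝ≥0∞}

theorem homogeneous_iff (hα : IsBarycentreMap α) (hg : LowerSemicontinuous g)
    (hgf : ∀ c, g (unit 𝒦 c) = f c) :
    IsHomogeneous f ↔ ∀ (r : ℝ≥0) (x : Kc 𝒦 C), g (smul α r x) = r * g x := by
  refine ⟨fun h r x => le_antisymm ?_ ?_, fun h r a => ?_⟩
  · exact le_of_lsc_of_unit (hg.comp (continuous_smul r continuous_id))
      (hg.ennreal_const_mul r) (fun a => by simp only [Function.comp_apply, id_eq, smul_unit hα, hgf, h r a, le_refl]) x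
  · exact le_of_lsc_of_unit (hg.ennreal_const_mul r)
      (hg.comp (continuous_smul r continuous_id))
      (fun a => by simp only [Function.comp_apply, id_eq, smul_unit hα, hgf, h r a, le_refl]) x
  · rw [← hgf, ← hgf, ← smul_unit hα, h]

/-- With one variable fixed, both sides are lower semicontinuous in the other, so the inequality
extends from `C` in two stages. The converse is restriction along the unit, which respects addition.
-/
theorem superadditive_iff (hα : IsBarycentreMap α) (hg : LowerSemicontinuous g)
    (hgf : ∀ c, g (unit 𝒦 c) = f c) :
    IsSuperadditive f ↔ ∀ x y : Kc 𝒦 C, g x + g y ≤ g (add α x y) := by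
  refine ⟨fun h x y => ?_, fun h a b => ?_⟩
  · revert x
    refine le_of_lsc_of_unit (hg.add lowerSemicontinuous_const)
      (hg.comp (continuous_add continuous_id continuous_const)) fun a => ?_
    revert y
    refine le_of_lsc_of_unit (lowerSemicontinuous_const.add hg)
      (hg.comp (continuous_add continuous_const continuous_id)) fun b => ?_
    simpa only [Function.comp_apply, id_eq, add_unit hα, hgf] using h a b
  · simpa only [add_unit hα, hgf] using h (unit 𝒦 a) (unit 𝒦 b)

theorem subadditive_iff (hα : IsBarycentreMap α) (hg : LowerSemicontinuous g)
    (hgf : ∀ c, g (unit 𝒦 c) = f c) :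
    IsSubadditive f ↔ ∀ x y : Kc 𝒦 C, g (add α x y) ≤ g x + g y := by
  refine ⟨fun h x y => ?_, fun h a b => ?_⟩
  · revert x
    refine le_of_lsc_of_unit (hg.comp (continuous_add continuous_id continuous_const))
      (hg.add lowerSemicontinuous_const) fun a => ?_
    revert y
    refine le_of_lsc_of_unit (hg.comp (continuous_add continuous_const continuous_id))
      (lowerSemicontinuous_const.add hg) fun b => ?_
    simpa only [Function.comp_apply, id_eq, add_unit hα, hgf] using h a b
  · simpa only [add_unit hα, hgf] using h (unit 𝒦 a) (unit 𝒦 b)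

end Cone

end Kc

theorem isAdditive_iff {C : Type u} [AddCommMonoid C] (f : C → ℝ≥0∞) :
    IsAdditive f ↔ IsSuperadditive f ∧ IsSubadditive f :=
  ⟨fun h => ⟨fun a b => (h a b).ge, fun a b => (h a b).le⟩,
    fun h a b => le_antisymm (h.2 a b) (h.1 a b)⟩

theorem mainTheorem5 (𝒦 : KCategory.{u}) (C : Type u) [AddCommMonoid C] [Module ℝ≥0 C]
    [TopologicalSpace C] (hC : IsTopologicalCone C) (hC' : WeaklyLocallyConvex C) :
    -- the structure map of `C` as a `𝒱_s`-algebra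
    ∃ α : C(Vs C, C), IsBarycentreMap α ∧
      -- the cone structure on the `𝒦`-completion of `C`
      ∃ (_ : AddCommMonoid (Kc 𝒦 C)) (_ : Module ℝ≥0 (Kc 𝒦 C)),
        (∀ x y : Kc 𝒦 C,
          x + y = Kc.map 𝒦 α (Kc.map 𝒦 Vs.unit x + Kc.map 𝒦 Vs.unit y)) ∧
        (∀ (r : ℝ≥0) (x : Kc 𝒦 C), r • x = Kc.map 𝒦 α (r • Kc.map 𝒦 Vs.unit x)) ∧
        ∀ f : C → ℝ≥0∞, LowerSemicontinuous f →
          ∃ g : Kc 𝒦 C → ℝ≥0∞,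
            -- `g` is the unique continuous extension of `f`
            (LowerSemicontinuous g ∧ (∀ c, g (Kc.unit 𝒦 c) = f c) ∧
              ∀ g' : Kc 𝒦 C → ℝ≥0∞, LowerSemicontinuous g' →
                (∀ c, g' (Kc.unit 𝒦 c) = f c) → g' = g) ∧
            (IsHomogeneous f ↔ IsHomogeneous g) ∧
            (IsSuperadditive f ↔ IsSuperadditive g) ∧
            (IsSubadditive f ↔ IsSubadditive g) ∧
            (IsSuperlinearFunctional f ↔ IsSuperlinearFunctional g) ∧
            (IsSublinearFunctional f ↔ IsSublinearFunctional g) ∧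
            (IsLinearFunctional f ↔ IsLinearFunctional g) := by
  obtain ⟨α, hα⟩ := exists_continuous_isBarycentreMap hC hC'
  let := Kc.addCommMonoidOfBarycentre (𝒦 := 𝒦) hα
  -- The required formulas are the definitions of the two operations.
  refine ⟨α, hα, this, Kc.moduleOfBarycentre hα, fun _ _ => rfl, fun _ _ => rfl, fun f hf => ?_⟩
  let := Kc.moduleOfBarycentre (𝒦 := 𝒦) hα
  have hg := Kc.lowerSemicontinuous_lscExtend (𝒦 := 𝒦) hf
  have hgf := Kc.lscExtend_unit (𝒦 := 𝒦) hf
  have hhom : IsHomogeneous f ↔ IsHomogeneous (Kc.lscExtend f : Kc 𝒦 C → ℝ≥0∞) :=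
    Kc.homogeneous_iff hα hg hgf
  have hsup : IsSuperadditive f ↔ IsSuperadditive (Kc.lscExtend f : Kc 𝒦 C → ℝ≥0∞) :=
    Kc.superadditive_iff hα hg hgf
  have hsub : IsSubadditive f ↔ IsSubadditive (Kc.lscExtend f : Kc 𝒦 C → ℝ≥0∞) :=
    Kc.subadditive_iff hα hg hgf
  refine ⟨Kc.lscExtend f, ⟨hg, hgf, fun g' hg' hg'f => funext fun A => le_antisymm ?_ ?_⟩,
    hhom, hsup, hsub, hhom.and hsup, hhom.and hsub, hhom.and ?_⟩
  · exact Kc.le_of_lsc_of_unit hg' hg (fun c => by rw [hg'f, hgf]) A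
  · exact Kc.le_of_lsc_of_unit hg hg' (fun c => by rw [hg'f, hgf]) A
  · rw [isAdditive_iff, isAdditive_iff, hsup, hsub]
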